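/- A two-way probabilistic counter automaton (2PCA) is a finite-state probabilistic machine with arbitrary real transition probabilities, a read-only head on the tape $\cent w\dollar$ that holds the input $w$ between two end-markers, and an integer counter that is initially $0$. The head starts on $\cent$. In each step, depending on the current state, the scanned symbol and whether the counter is zero, the machine chooses at random a new state, a head move in $\{-1,0,1\}$ (never leaving $\cent w\dollar$) and a change of the counter in $\{-1,0,1\}$; it halts on entering its accepting or its rejecting state. It is *sweeping* if, on every computation path of nonzero probability, the direction of the head changes only on the end-markers. It recognizes a language $L$ with *bounded error* if for some $\varepsilon<1/2$ every $w\in L$ is accepted with probability at least $1-\varepsilon$ and every $w\notin L$ is rejected with probability at least $1-\varepsilon$. It runs in *space* $s(n)$ if, on every input of length $n$, the absolute value of the counter is at most $s(n)$ at every moment of every computation path of nonzero probability. 1. For every unbounded function $s:\mathbb{N}\to\mathbb{N}$, the set of languages over a binary alphabet that are recognized by bounded-error sweeping PCAs in space $s(n)$ is uncountable. 2. The set of languages over a binary alphabet that are recognized by bounded-error sweeping PCAs that run in space $O(\log n)$ and in expected time $2^{O(n)}$ is uncountable. -/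

import Mathlib

open Filter Asymptotics
open scoped ENNReal

/-- The tape alphabet: the input symbols together with the two end-markers. -/
inductive TapeSymbol (α : Type) : Type
  | leftEnd : TapeSymbol α
  | sym (a : α) : TapeSymbol α
  | rightEnd : TapeSymbol α

/-- The symbol in cell `i` of the tape that holds `w` between the two end-markers: the left
end-marker is in cell `0`, the letters of `w` are in the cells `1, …, |w|`, and the right
end-marker is in cell `|w| + 1`. -/
def tapeSymbolAt {α : Type} (w : List α) : ℕ → TapeSymbol α
  | 0 => TapeSymbol.leftEnd
  | i + 1 => if h : i < w.length then TapeSymbol.sym w[i] else TapeSymbol.rightEnd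

/-- The effect of one transition: the next state, the move of the input head and the change of
the counter.  Moves and changes are `-1`, `0` or `1`; the head move `-1` is to the left. -/
structure PCAAction (Q : Type) : Type where
  state : Q
  move : SignType
  change : SignType

/-- A two-way probabilistic one-counter automaton with arbitrary real transition probabilities.
`δ q σ z` is the distribution of the action taken in state `q` when the head reads `σ`; the bit
`z` tells whether the value of the counter is zero. -/
structure TwoWayPCA (α : Type) : Type 1 where
  Q : Type
  finite_Q : Finite Q
  start : Q
  acc : Q
  rej : Q
  acc_ne_rej : acc ≠ rej
  δ : Q → TapeSymbol α → Bool → PMF (PCAAction Q)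
  /-- the head does not leave the tape through the left end-marker -/
  not_left : ∀ q z, ∀ a ∈ (δ q TapeSymbol.leftEnd z).support, a.move ≠ -1
  /-- the head does not leave the tape through the right end-marker -/
  not_right : ∀ q z, ∀ a ∈ (δ q TapeSymbol.rightEnd z).support, a.move ≠ 1

/-- A configuration: the state, the position of the head and the (integer) counter value. -/
structure PCAConfig (Q : Type) : Type where
  state : Q
  head : ℕ
  counter : ℤ

namespace TwoWayPCA

variable {α : Type} (M : TwoWayPCA α)

/-- The initial configuration: the head is on the left end-marker and the counter is zero. -/
def init : PCAConfig M.Q := ⟨M.start, 0, 0⟩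

/-- The computation terminates as soon as the accepting or the rejecting state is entered. -/
def Halted (c : PCAConfig M.Q) : Prop := c.state = M.acc ∨ c.state = M.rej

/-- The configuration that results from `c` by the action `a`. -/
def next (c : PCAConfig M.Q) (a : PCAAction M.Q) : PCAConfig M.Q :=
  ⟨a.state, ((c.head : ℤ) + (a.move : ℤ)).toNat, c.counter + (a.change : ℤ)⟩

/-- The distribution of the action taken in configuration `c` on input `w`. -/
noncomputable def actionDist (w : List α) (c : PCAConfig M.Q) : PMF (PCAAction M.Q) :=
  M.δ c.state (tapeSymbolAt w c.head) (decide (c.counter = 0))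

open Classical in
/-- One step of the computation on input `w`; halted configurations do not change any more. -/
noncomputable def step (w : List α) (c : PCAConfig M.Q) : PMF (PCAConfig M.Q) :=
  if M.Halted c then PMF.pure c else (M.actionDist w c).map (M.next c)

/-- The distribution of the configuration after `t` steps on input `w`. -/
noncomputable def distAt (w : List α) : ℕ → PMF (PCAConfig M.Q)
  | 0 => PMF.pure M.init
  | t + 1 => (distAt w t).bind (M.step w)

/-- The probability that the computation on `w` enters the accepting state (the limit of the
nondecreasing sequence of the probabilities to have accepted within `t` steps). -/
noncomputable def acceptProb (w : List α) : ℝ≥0∞ :=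
  ⨆ t : ℕ, (M.distAt w t).toOuterMeasure {c | c.state = M.acc}

/-- The probability that the computation on `w` enters the rejecting state. -/
noncomputable def rejectProb (w : List α) : ℝ≥0∞ :=
  ⨆ t : ℕ, (M.distAt w t).toOuterMeasure {c | c.state = M.rej}

/-- The expected number `E[T]` of steps of the computation on `w`, as `∑ t, P(T > t)`. -/
noncomputable def expectedTime (w : List α) : ℝ≥0∞ :=
  ∑' t : ℕ, (M.distAt w t).toOuterMeasure {c | ¬ M.Halted c}

/-- `M` recognizes `L` with bounded error. -/
def RecognizesBoundedError (L : Language α) : Prop :=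
  ∃ ε : ℝ≥0∞, ε < 1 / 2 ∧
    (∀ w : List α, w ∈ L → 1 - ε ≤ M.acceptProb w) ∧
    (∀ w : List α, w ∉ L → 1 - ε ≤ M.rejectProb w)

/-- `M` runs in space `s(n)`: on every input of length `n`, the absolute value of the counter is
at most `s(n)` in every configuration that occurs with nonzero probability. -/
def RunsInSpace (s : ℕ → ℕ) : Prop :=
  ∀ (w : List α) (t : ℕ), ∀ c ∈ (M.distAt w t).support, c.counter.natAbs ≤ s w.length

/-- `M` runs in expected time `T(n)`. -/
def RunsInExpectedTime (T : ℕ → ℕ) : Prop :=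
  ∀ w : List α, M.expectedTime w ≤ (T w.length : ℝ≥0∞)

/-- `M` runs in space `O(log n)`. -/
def RunsInLogSpace : Prop :=
  ∃ s : ℕ → ℕ, M.RunsInSpace s ∧
    (fun n : ℕ => (s n : ℝ)) =O[atTop] (fun n : ℕ => Real.log (n : ℝ))

/-- `M` runs in expected time `2 ^ O(n)`. -/
def RunsInExponentialExpectedTime : Prop :=
  ∃ (T : ℕ → ℕ) (k : ℕ), M.RunsInExpectedTime T ∧
    (fun n : ℕ => (T n : ℝ)) =O[atTop] (fun n : ℕ => (2 : ℝ) ^ (k * n))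

/-- `M.Path w c d`: on input `w`, some computation path with nonzero probability leads from the
initial configuration to `c`, and `d` is the last nonzero head move on it (`1` if the head has
not moved yet). -/
inductive Path (w : List α) : PCAConfig M.Q → SignType → Prop
  | init : Path w M.init 1
  | step {c : PCAConfig M.Q} {d : SignType} {a : PCAAction M.Q} (hp : Path w c d)
      (hc : ¬ M.Halted c) (ha : a ∈ (M.actionDist w c).support) :
      Path w (M.next c a) (if a.move = 0 then d else a.move)

/-- `M` is sweeping: the direction of the head is changed only on the end-markers. -/
def IsSweeping : Prop :=
  ∀ (w : List α) (c : PCAConfig M.Q) (d : SignType) (a : PCAAction M.Q),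
    M.Path w c d → ¬ M.Halted c → a ∈ (M.actionDist w c).support →
    a.move ≠ 0 → a.move ≠ d →
    tapeSymbolAt w c.head = TapeSymbol.leftEnd ∨ tapeSymbolAt w c.head = TapeSymbol.rightEnd

end TwoWayPCA

open scoped NNReal

/-!
The machines below never touch the counter: already sweeping two-way probabilistic *finite*
automata with real transition probabilities recognize uncountably many languages with bounded
error in exponential expected time, which gives both claims at once.

Such a machine repeats a one-way scan of the input.  A scan of `w` ends with the verdict "accept"
with probability `A w`, with "reject" with probability `R w`, and otherwise the head goes back and
scans again.  The machine thus accepts with probability `A w / (A w + R w)`, so it suffices that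
for every word one of `A w`, `R w` is at least twice the other; the expected time is
`O(n / (A w + R w))`.  See `ScanAutomaton.recognizesBoundedError` and
`ScanAutomaton.expectedTime_le`.

The languages are defined by a threshold `x`.  A word, read as blocks of letters `false` separated
by letters `true`, has block lengths `r, n₁, …, n_k`.  It is to be accepted if the later blocks
are the powers `4 ^ (k - 1), …, 4, 1` and `r < x * n₁`.  Both conditions are tested by
multiplicatively separated probabilities.

* The equations `nᵢ = 4 * nᵢ₊₁` and `n_k = 1` are of the form `i = j`.  The product over them of
  `16⁻ⁱ * 16⁻ʲ` (`geomProd`) is at most the product of `(16⁻²ⁱ + 16⁻²ʲ) / 2` (`arithProd`), with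
  equality if they all hold, and it is smaller by a factor of `8` or more otherwise.
* `512 ^ (-r)` is compared with `512 ^ (-x * n₁)`; the latter uses that transition probabilities
  are arbitrary reals.  If the fractional part of `x * 4 ^ i` is in `[1 / 3, 2 / 3]` for all `i`,
  then `r ≥ x * n₁` implies that the second number exceeds the first by a factor of `8` or more.

With `A` half the product of `geomProd` and `512 ^ (-r)`, and `R` an eighth of the product of
`arithProd` and `512 ^ (-r) + 512 ^ (-x * n₁)`, the required gap is `weight_gap`.  The numbers
whose base-four digits are all `1` or `2` are uncountably many such thresholds, and distinct
thresholds are told apart by some `r` and `n₁ = 4 ^ i` (`thresholdLanguage_injective`).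
-/

/-! ### Expectations with respect to discrete distributions -/

namespace PMF

variable {β γ : Type}

/-- The expectation of a nonnegative function under a discrete distribution. -/
noncomputable def expect (p : PMF β) (f : β → ℝ≥0∞) : ℝ≥0∞ := ∑' x, p x * f x

theorem expect_pure (x : β) (f : β → ℝ≥0∞) : (PMF.pure x).expect f = f x := by
  rw [expect, tsum_eq_single x]
  · simp
  · intro y hy
    simp [hy]

theorem expect_bind (p : PMF β) (k : β → PMF γ) (f : γ → ℝ≥0∞) :
    (p.bind k).expect f = p.expect fun x => (k x).expect f := by
  simp only [expect, bind_apply, ← ENNReal.tsum_mul_right, ← ENNReal.tsum_mul_left]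
  rw [ENNReal.tsum_comm]
  simp only [mul_assoc]

theorem expect_map (p : PMF β) (g : β → γ) (f : γ → ℝ≥0∞) :
    (p.map g).expect f = p.expect (f ∘ g) := by
  rw [← bind_pure_comp, expect_bind]
  simp only [Function.comp_def, expect_pure]

theorem expect_le_one (p : PMF β) {f : β → ℝ≥0∞} (hf : ∀ x, f x ≤ 1) : p.expect f ≤ 1 := by
  rw [← p.tsum_coe]
  exact ENNReal.tsum_le_tsum fun x => mul_le_of_le_one_right' (hf x)

open Classical in
theorem toOuterMeasure_eq_expect (p : PMF β) (s : Set β) :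
    p.toOuterMeasure s = p.expect fun x => if x ∈ s then 1 else 0 := by
  rw [toOuterMeasure_apply, expect]
  exact tsum_congr fun x => by by_cases h : x ∈ s <;> simp [h]

/-- The distribution on `Option β` in which the mass missing from a family of weights of total
at most one is put on `none`. -/
noncomputable def complete [Fintype β] (f : β → ℝ≥0) (h : ∑ x, f x ≤ 1) : PMF (Option β) :=
  PMF.ofFintype (fun o => o.elim (1 - ∑ x, (f x : ℝ≥0∞)) fun x => f x) (by
    rw [Fintype.sum_option]
    exact tsub_add_cancel_of_le (by exact_mod_cast h))

theorem complete_some [Fintype β] (f : β → ℝ≥0) (h : ∑ x, f x ≤ 1) (x : β) :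
    complete f h (some x) = f x := rfl

end PMF

namespace TwoWayPCA

variable {α : Type} (M : TwoWayPCA α) (w : List α)

/-- The operator that sends a function on configurations to its expected value after one more
step. -/
noncomputable def lookahead (f : PCAConfig M.Q → ℝ≥0∞) (c : PCAConfig M.Q) : ℝ≥0∞ :=
  (M.step w c).expect f

theorem expect_distAt (t : ℕ) (f : PCAConfig M.Q → ℝ≥0∞) :
    (M.distAt w t).expect f = (M.lookahead w)^[t] f M.init := by
  induction t generalizing f with
  | zero => exact PMF.expect_pure _ _
  | succ t ih => rw [distAt, PMF.expect_bind, Function.iterate_succ_apply, ← ih]; rfl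

theorem lookahead_iterate_le_one (t : ℕ) {f : PCAConfig M.Q → ℝ≥0∞} (hf : ∀ c, f c ≤ 1)
    (c : PCAConfig M.Q) : (M.lookahead w)^[t] f c ≤ 1 := by
  induction t generalizing c with
  | zero => exact hf c
  | succ t ih => rw [Function.iterate_succ_apply']; exact PMF.expect_le_one _ ih

theorem lookahead_of_halted {c : PCAConfig M.Q} (hc : M.Halted c) (f : PCAConfig M.Q → ℝ≥0∞) :
    M.lookahead w f c = f c := by
  rw [lookahead, step, if_pos hc, PMF.expect_pure]

theorem lookahead_iterate_of_halted {c : PCAConfig M.Q} (hc : M.Halted c) (t : ℕ)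
    (f : PCAConfig M.Q → ℝ≥0∞) : (M.lookahead w)^[t] f c = f c := by
  induction t with
  | zero => rfl
  | succ t ih => rw [Function.iterate_succ_apply', lookahead_of_halted M w hc, ih]

theorem lookahead_of_not_halted {c : PCAConfig M.Q} (hc : ¬ M.Halted c)
    (f : PCAConfig M.Q → ℝ≥0∞) :
    M.lookahead w f c = (M.actionDist w c).expect fun a => f (M.next c a) := by
  rw [lookahead, step, if_neg hc, PMF.expect_map]; rfl

end TwoWayPCA

/-! ### Machines that repeat a one-way probabilistic scan until it gives a verdict -/

/-- A one-way probabilistic automaton given by substochastic weights: missing mass means that the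
scan gives no verdict.  After the last letter, state `s` gives the verdict `b` with probability
`out s b`, where `true` stands for acceptance. -/
structure ScanAutomaton (α : Type) : Type 1 where
  σ : Type
  fintype_σ : Fintype σ
  init : σ → ℝ≥0
  trans : σ → α → σ → ℝ≥0
  out : σ → Bool → ℝ≥0
  init_le : ∑ s, init s ≤ 1
  trans_le : ∀ s a, ∑ s', trans s a s' ≤ 1
  out_le : ∀ s, ∑ b, out s b ≤ 1

namespace ScanAutomaton

attribute [instance] ScanAutomaton.fintype_σ

variable {α : Type} (S : ScanAutomaton α)

/-- The probability of the verdict `b` when the scan of the remaining word starts in `s`. -/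
noncomputable def val (b : Bool) : List α → S.σ → ℝ≥0
  | [], s => S.out s b
  | a :: w, s => ∑ s', S.trans s a s' * val b w s'

/-- The probability that one scan of `w` gives the verdict `b`. -/
noncomputable def weight (b : Bool) (w : List α) : ℝ≥0 := ∑ s, S.init s * S.val b w s

/-- The transitions of the scan; `none` is the state of a scan that gives no verdict. -/
noncomputable def transDist : Option S.σ → α → PMF (Option S.σ)
  | none, _ => PMF.pure none
  | some s, a => PMF.complete (S.trans s a) (S.trans_le s a)

/-- The distribution of the verdict after the last letter. -/
noncomputable def outDist : Option S.σ → PMF (Option Bool)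
  | none => PMF.pure none
  | some s => PMF.complete (S.out s) (S.out_le s)

/-- The distribution of the state in which the scan starts. -/
noncomputable def initDist : PMF (Option S.σ) := PMF.complete S.init S.init_le

/-- The distribution of the state after scanning a word. -/
noncomputable def scanDist : List α → Option S.σ → PMF (Option S.σ)
  | [], s => PMF.pure s
  | a :: w, s => (S.transDist s a).bind (scanDist w)

/-- The distribution of the verdict of one scan. -/
noncomputable def verdict (w : List α) : PMF (Option Bool) :=
  S.initDist.bind fun s => (S.scanDist w s).bind S.outDist

theorem scanDist_bind_outDist_none (w : List α) :
    (S.scanDist w none).bind S.outDist = PMF.pure none := by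
  induction w with
  | nil => simp [scanDist, outDist]
  | cons a w ih => simpa [scanDist, transDist] using ih

theorem scanDist_bind_outDist_some (b : Bool) (w : List α) (s : S.σ) :
    ((S.scanDist w (some s)).bind S.outDist) (some b) = S.val b w s := by
  induction w generalizing s with
  | nil => simp [scanDist, outDist, val, PMF.complete_some]
  | cons a w ih =>
    rw [scanDist, PMF.bind_bind, PMF.bind_apply, tsum_fintype, Fintype.sum_option,
      scanDist_bind_outDist_none]
    simp [ih, val, transDist, PMF.complete_some]

theorem verdict_some (w : List α) (b : Bool) : S.verdict w (some b) = S.weight b w := by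
  rw [verdict, PMF.bind_apply, tsum_fintype, Fintype.sum_option, scanDist_bind_outDist_none]
  simp only [scanDist_bind_outDist_some, weight, initDist, PMF.complete_some]
  simp

theorem verdict_sum (w : List α) :
    S.verdict w none + (S.weight true w + S.weight false w) = 1 := by
  have h := (S.verdict w).tsum_coe
  rw [tsum_fintype, Fintype.sum_option, Fintype.sum_bool] at h
  simpa [verdict_some] using h

/-- The states of the repeating machine: `scan s` while the head moves to the right, `back` while
it returns to the left end-marker, and `halt b` after the verdict `b`. -/
inductive RepeatState (σ : Type) : Type
  | scan (s : Option σ)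
  | back
  | halt (b : Bool)

instance RepeatState.instFinite (σ : Type) [Finite σ] : Finite (RepeatState σ) :=
  Finite.of_surjective
    (fun x : Option σ ⊕ Option Bool =>
      x.elim RepeatState.scan fun o => o.elim RepeatState.back RepeatState.halt)
    (by
      rintro (s | _ | b)
      · exact ⟨Sum.inl s, rfl⟩
      · exact ⟨Sum.inr none, rfl⟩
      · exact ⟨Sum.inr (some b), rfl⟩)

/-- The action that starts or continues a scan in state `s`. -/
def scanAction (s : Option S.σ) : PCAAction (RepeatState S.σ) := ⟨.scan s, 1, 0⟩

/-- The action on the right end-marker: without a verdict, the head goes back. -/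
def outAction : Option Bool → PCAAction (RepeatState S.σ)
  | none => ⟨.back, -1, 0⟩
  | some b => ⟨.halt b, 0, 0⟩

/-- The transition function of the repeating machine; the counter is never used. -/
noncomputable def repeatStep :
    RepeatState S.σ → TapeSymbol α → PMF (PCAAction (RepeatState S.σ))
  | .scan s, .leftEnd => PMF.pure (S.scanAction s)
  | .scan s, .sym a => (S.transDist s a).map S.scanAction
  | .scan s, .rightEnd => (S.outDist s).map S.outAction
  | .back, .leftEnd => S.initDist.map S.scanAction
  | .back, .sym _ => PMF.pure (S.outAction none)
  | .back, .rightEnd => PMF.pure (S.outAction none)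
  | .halt b, _ => PMF.pure (S.outAction (some b))

/-- The sweeping machine that scans the input again and again until a scan gives a verdict. -/
noncomputable abbrev toPCA : TwoWayPCA α where
  Q := RepeatState S.σ
  finite_Q := inferInstance
  start := .back
  acc := .halt true
  rej := .halt false
  acc_ne_rej := by simp
  δ q x _ := S.repeatStep q x
  not_left := by
    rintro (s | _ | b) z a ha <;> simp only [repeatStep, PMF.mem_support_map_iff,
      PMF.mem_support_pure_iff] at ha
    · subst ha; simp [scanAction]
    · obtain ⟨s, -, rfl⟩ := ha; simp [scanAction]
    · subst ha; simp [outAction]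
  not_right := by
    rintro (s | _ | b) z a ha <;> simp only [repeatStep, PMF.mem_support_map_iff,
      PMF.mem_support_pure_iff] at ha
    · obtain ⟨_ | b, -, rfl⟩ := ha <;> simp [outAction]
    · subst ha; simp [outAction]
    · subst ha; simp [outAction]

/-- Every transition of the repeating machine either continues a scan to the right, or is one of
the actions of the right end-marker, whatever symbol is read. -/
theorem mem_support_repeatStep {q : RepeatState S.σ} {x : TapeSymbol α}
    {a : PCAAction (RepeatState S.σ)} (ha : a ∈ (S.repeatStep q x).support) :
    (∃ s, a = S.scanAction s) ∨ ∃ o, a = S.outAction o := by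
  rcases q with s | _ | b <;> rcases x with _ | y | _ <;>
    simp only [repeatStep, PMF.mem_support_map_iff, PMF.mem_support_pure_iff] at ha <;>
    aesop

theorem counter_eq_zero (w : List α) (t : ℕ) :
    ∀ c ∈ (S.toPCA.distAt w t).support, c.counter = 0 := by
  induction t with
  | zero => intro c hc; simp [TwoWayPCA.distAt] at hc; subst hc; rfl
  | succ t ih =>
    intro c hc
    rw [TwoWayPCA.distAt, PMF.mem_support_bind_iff] at hc
    obtain ⟨d, hd, hc⟩ := hc
    rw [TwoWayPCA.step] at hc
    split_ifs at hc
    · rw [PMF.mem_support_pure_iff] at hc; exact hc ▸ ih d hd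
    · rw [PMF.mem_support_map_iff] at hc
      obtain ⟨a, ha, rfl⟩ := hc
      have h0 := ih d hd
      rcases S.mem_support_repeatStep ha with ⟨s, rfl⟩ | ⟨_ | b, rfl⟩ <;>
        simp [TwoWayPCA.next, scanAction, outAction, h0]

theorem runsInSpace (s : ℕ → ℕ) : S.toPCA.RunsInSpace s := by
  intro w t c hc
  simp [S.counter_eq_zero w t c hc]

/-- During a scan the head has last moved to the right; on the way back it has last moved to the
left, or is still in its initial position. -/
theorem direction_of_path {w : List α} {c : PCAConfig S.toPCA.Q} {d : SignType}
    (h : S.toPCA.Path w c d) :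
    (∀ s, c.state = RepeatState.scan s → d = 1) ∧
      (c.state = RepeatState.back → c.head = 0 ∨ d = -1) := by
  induction h with
  | init => exact ⟨fun s hs => rfl, fun _ => Or.inl rfl⟩
  | @step c d a hp hc ha ih =>
    rcases S.mem_support_repeatStep ha with ⟨s, rfl⟩ | ⟨_ | b, rfl⟩ <;>
      simp [TwoWayPCA.next, scanAction, outAction]

theorem isSweeping : S.toPCA.IsSweeping := by
  intro w c d a hp hc ha h0 hd
  obtain ⟨h1, h2⟩ := S.direction_of_path hp
  obtain ⟨q, i, k⟩ := c
  replace ha : a ∈ (S.repeatStep q (tapeSymbolAt w i)).support := ha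
  change tapeSymbolAt w i = _ ∨ tapeSymbolAt w i = _
  rcases hx : tapeSymbolAt w i with _ | y | _
  · exact Or.inl rfl
  · exfalso
    rw [hx] at ha
    rcases q with s | _ | b <;>
      simp only [repeatStep, PMF.mem_support_map_iff, PMF.mem_support_pure_iff] at ha
    · obtain ⟨s', -, rfl⟩ := ha
      exact hd (h1 s rfl).symm
    · subst ha
      rcases h2 rfl with h | h
      · change i = 0 at h
        subst h
        cases hx
      · exact hd h.symm
    · subst ha; exact h0 rfl
  · exact Or.inr rfl

/-! ### The probabilities of the verdicts and the expected time -/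

section Rounds

variable (w : List α) (f : PCAConfig S.toPCA.Q → ℝ≥0∞)

theorem halted_iff (c : PCAConfig S.toPCA.Q) : S.toPCA.Halted c ↔ ∃ b, c.state = .halt b := by
  constructor
  · rintro (h | h)
    exacts [⟨_, h⟩, ⟨_, h⟩]
  · rintro ⟨_ | _, h⟩
    exacts [Or.inr h, Or.inl h]

theorem lookahead_back_zero :
    S.toPCA.lookahead w f ⟨.back, 0, 0⟩ = S.initDist.expect fun s => f ⟨.scan s, 1, 0⟩ := by
  rw [TwoWayPCA.lookahead_of_not_halted _ _ (by simp [halted_iff])]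
  exact PMF.expect_map _ _ _

theorem lookahead_back_succ (i : ℕ) :
    S.toPCA.lookahead w f ⟨.back, i + 1, 0⟩ = f ⟨.back, i, 0⟩ := by
  rw [TwoWayPCA.lookahead_of_not_halted _ _ (by simp [halted_iff])]
  have h : S.toPCA.actionDist w ⟨.back, i + 1, 0⟩ = PMF.pure (S.outAction none) := by
    change S.repeatStep .back (tapeSymbolAt w (i + 1)) = _
    simp only [tapeSymbolAt]
    split_ifs <;> rfl
  rw [h, PMF.expect_pure]
  simp [TwoWayPCA.next, outAction]

theorem lookahead_iterate_back (i : ℕ) :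
    (S.toPCA.lookahead w)^[i] f ⟨.back, i, 0⟩ = f ⟨.back, 0, 0⟩ := by
  induction i with
  | zero => rfl
  | succ i ih => rw [Function.iterate_succ_apply', lookahead_back_succ, ih]

theorem lookahead_scan_sym (s : Option S.σ) {i : ℕ} (hi : i < w.length) :
    S.toPCA.lookahead w f ⟨.scan s, i + 1, 0⟩ =
      (S.transDist s w[i]).expect fun s' => f ⟨.scan s', i + 2, 0⟩ := by
  rw [TwoWayPCA.lookahead_of_not_halted _ _ (by simp [halted_iff])]
  have h : S.toPCA.actionDist w ⟨.scan s, i + 1, 0⟩ =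
      (S.transDist s w[i]).map S.scanAction := by
    change S.repeatStep (.scan s) (tapeSymbolAt w (i + 1)) = _
    simp only [tapeSymbolAt, hi, dif_pos]
    rfl
  rw [h, PMF.expect_map]
  rfl

theorem lookahead_scan_rightEnd (s : Option S.σ) :
    S.toPCA.lookahead w f ⟨.scan s, w.length + 1, 0⟩ =
      (S.outDist s).expect fun o =>
        o.elim (f ⟨.back, w.length, 0⟩) fun b => f ⟨.halt b, w.length + 1, 0⟩ := by
  rw [TwoWayPCA.lookahead_of_not_halted _ _ (by simp [halted_iff])]
  have h : S.toPCA.actionDist w ⟨.scan s, w.length + 1, 0⟩ = (S.outDist s).map S.outAction := by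
    change S.repeatStep (.scan s) (tapeSymbolAt w (w.length + 1)) = _
    simp only [tapeSymbolAt, lt_irrefl, dif_neg, not_false_iff]
    rfl
  rw [h, PMF.expect_map]
  congr 1
  ext o
  rcases o with _ | b <;> simp [TwoWayPCA.next, outAction]

theorem lookahead_iterate_scan (l : List α) (s : Option S.σ) {i : ℕ} (hl : w.drop i = l)
    (hi : i ≤ w.length) :
    (S.toPCA.lookahead w)^[l.length] f ⟨.scan s, i + 1, 0⟩ =
      (S.scanDist l s).expect fun s' => f ⟨.scan s', w.length + 1, 0⟩ := by
  induction l generalizing i s with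
  | nil =>
    have : i = w.length := le_antisymm hi (List.drop_eq_nil_iff.mp hl)
    subst this
    rw [scanDist, PMF.expect_pure]; rfl
  | cons a l ih =>
    have hi' : i < w.length := by
      by_contra h
      rw [List.drop_eq_nil_of_le (not_lt.mp h)] at hl
      cases hl
    rw [List.drop_eq_getElem_cons hi'] at hl
    obtain ⟨rfl, hl'⟩ := List.cons.inj hl
    rw [List.length_cons, Function.iterate_succ_apply', lookahead_scan_sym S w _ s hi', scanDist,
      PMF.expect_bind]
    congr 1
    ext s'
    exact ih s' hl' hi'

/-- The number of steps of one round without a verdict: the start, the scan of the word, the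
turn on the right end-marker and the way back. -/
def roundLength : ℕ := 1 + (w.length + (1 + w.length))

theorem lookahead_round :
    (S.toPCA.lookahead w)^[roundLength w] f ⟨.back, 0, 0⟩ =
      S.verdict w none * f ⟨.back, 0, 0⟩ +
        (S.weight true w * f ⟨.halt true, w.length + 1, 0⟩ +
          S.weight false w * f ⟨.halt false, w.length + 1, 0⟩) := by
  have hb (b : Bool) : (S.toPCA.lookahead w)^[w.length] f ⟨.halt b, w.length + 1, 0⟩ =
      f ⟨.halt b, w.length + 1, 0⟩ :=
    TwoWayPCA.lookahead_iterate_of_halted _ _ ((S.halted_iff _).2 ⟨b, rfl⟩) _ _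
  rw [roundLength, Function.iterate_add_apply, Function.iterate_add_apply,
    Function.iterate_add_apply, Function.iterate_one, lookahead_back_zero]
  have hscan (s : Option S.σ) :
      (S.toPCA.lookahead w)^[w.length] (S.toPCA.lookahead w ((S.toPCA.lookahead w)^[w.length] f))
        ⟨.scan s, 1, 0⟩ = ((S.scanDist w s).bind S.outDist).expect fun o =>
          o.elim (f ⟨.back, 0, 0⟩) fun b => f ⟨.halt b, w.length + 1, 0⟩ := by
    refine (S.lookahead_iterate_scan w _ w s (i := 0) rfl (Nat.zero_le _)).trans ?_
    rw [PMF.expect_bind]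
    refine congrArg (S.scanDist w s).expect (funext fun s' => ?_)
    rw [lookahead_scan_rightEnd, lookahead_iterate_back]
    exact congrArg (S.outDist s').expect (funext fun o => by cases o <;> simp [hb])
  refine (congrArg S.initDist.expect (funext hscan)).trans ?_
  rw [← PMF.expect_bind, ← verdict, PMF.expect, tsum_fintype, Fintype.sum_option,
    Fintype.sum_bool]
  simp only [verdict_some]
  rfl

/-- Before the verdict, rounds form a geometric sequence. -/
theorem lookahead_rounds (k : ℕ) (hf : ∀ c, S.toPCA.Halted c → f c = 0) :
    (S.toPCA.lookahead w)^[roundLength w * k] f ⟨.back, 0, 0⟩ =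
      S.verdict w none ^ k * f ⟨.back, 0, 0⟩ := by
  induction k with
  | zero => simp
  | succ k ih =>
    have hb (b : Bool) : (S.toPCA.lookahead w)^[roundLength w * k] f
        ⟨.halt b, w.length + 1, 0⟩ = 0 := by
      have h := (S.halted_iff ⟨.halt b, w.length + 1, 0⟩).2 ⟨b, rfl⟩
      rw [TwoWayPCA.lookahead_iterate_of_halted _ _ h, hf _ h]
    rw [Nat.mul_succ, add_comm, Function.iterate_add_apply, lookahead_round, ih, hb, hb]
    ring

/-- The probability that the computation on `w` ends with the verdict `b`. -/
noncomputable def verdictProb (b : Bool) : ℝ≥0∞ :=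
  ⨆ t : ℕ, (S.toPCA.distAt w t).toOuterMeasure {c | c.state = .halt b}

open Classical in
/-- Conditioning on the first round bounds the probability of a verdict from below. -/
theorem weight_le_mul_verdictProb (b : Bool) :
    S.weight b w ≤ (S.weight true w + S.weight false w) * S.verdictProb w b := by
  set f : PCAConfig S.toPCA.Q → ℝ≥0∞ := fun c => if c.state = .halt b then 1 else 0 with hf
  set u : ℕ → ℝ≥0∞ := fun k => (S.toPCA.lookahead w)^[roundLength w * k] f ⟨.back, 0, 0⟩
    with hu
  have hp (t : ℕ) : (S.toPCA.distAt w t).toOuterMeasure {c | c.state = .halt b} =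
      (S.toPCA.lookahead w)^[t] f ⟨.back, 0, 0⟩ := by
    rw [PMF.toOuterMeasure_eq_expect, TwoWayPCA.expect_distAt]
    rfl
  have hle (t : ℕ) : (S.toPCA.lookahead w)^[t] f ⟨.back, 0, 0⟩ ≤ 1 :=
    TwoWayPCA.lookahead_iterate_le_one _ _ _ (fun c => by simp only [hf]; split_ifs <;> simp) _
  have hrec (k : ℕ) : u (k + 1) = S.verdict w none * u k + S.weight b w := by
    have hb (b' : Bool) : (S.toPCA.lookahead w)^[roundLength w * k] f
        ⟨.halt b', w.length + 1, 0⟩ = if b' = b then 1 else 0 := by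
      rw [TwoWayPCA.lookahead_iterate_of_halted _ _ ((S.halted_iff _).2 ⟨b', rfl⟩)]
      simp [hf]
    simp only [hu]
    rw [Nat.mul_succ, add_comm, Function.iterate_add_apply, lookahead_round, hb, hb]
    cases b <;> simp
  -- In the limit, the recursion becomes an inequality for the supremum along whole rounds.
  have hsup : S.verdict w none * (⨆ k, u k) + S.weight b w ≤ ⨆ k, u k := by
    rw [ENNReal.mul_iSup, ENNReal.iSup_add]
    exact iSup_le fun k => hrec k ▸ le_iSup u (k + 1)
  have h1 : (⨆ k, u k) ≤ 1 := iSup_le fun k => hle _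
  have hv : (⨆ k, u k) ≤ S.verdictProb w b :=
    iSup_le fun k => (hp _).symm.le.trans (le_iSup (fun t => (S.toPCA.distAt w t).toOuterMeasure
      {c | c.state = .halt b}) (roundLength w * k))
  refine le_trans ?_ (mul_le_mul_right hv _)
  have hfin : S.verdict w none * (⨆ k, u k) ≠ ⊤ :=
    ENNReal.mul_ne_top (PMF.apply_ne_top _ _) (ne_top_of_le_ne_top ENNReal.one_ne_top h1)
  refine (ENNReal.add_le_add_iff_left hfin).1 (hsup.trans_eq ?_)
  rw [← add_mul, verdict_sum, one_mul]

open Classical in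
/-- The expected number of rounds is the mean of a geometric distribution. -/
theorem expectedTime_le :
    S.toPCA.expectedTime w ≤
      roundLength w * (S.weight true w + S.weight false w : ℝ≥0∞)⁻¹ := by
  set D : ℝ≥0∞ := S.verdict w none
  have : NeZero (roundLength w) := ⟨by simp [roundLength]⟩
  have hp (k j : ℕ) : (S.toPCA.distAt w (roundLength w * k + j)).toOuterMeasure
      {c | ¬ S.toPCA.Halted c} ≤ D ^ k := by
    rw [PMF.toOuterMeasure_eq_expect, TwoWayPCA.expect_distAt, Function.iterate_add_apply]
    refine (S.lookahead_rounds w _ k fun c hc => ?_).trans_le ?_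
    · rw [TwoWayPCA.lookahead_iterate_of_halted _ _ hc]
      simp [hc]
    · exact mul_le_of_le_one_right' (TwoWayPCA.lookahead_iterate_le_one _ _ _
        (fun c => by split_ifs <;> simp) _)
  have hsum : 1 - D = S.weight true w + S.weight false w := by
    rw [← S.verdict_sum w]
    exact ENNReal.add_sub_cancel_left (PMF.apply_ne_top _ _)
  rw [TwoWayPCA.expectedTime, ← (Nat.divModEquiv (roundLength w)).symm.tsum_eq,
    ENNReal.tsum_prod', ← hsum, ← ENNReal.tsum_geometric, ← ENNReal.tsum_mul_left]
  refine ENNReal.tsum_le_tsum fun k => ?_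
  rw [tsum_fintype]
  refine (Finset.sum_le_card_nsmul _ _ (D ^ k) fun j _ => ?_).trans_eq ?_
  · rw [Nat.divModEquiv_symm_apply, mul_comm]
    exact hp k j
  · simp

end Rounds

/-- If on every word one verdict is at least twice as probable as the other in a scan, then the
repeating machine recognizes the words on which acceptance is more probable. -/
theorem recognizesBoundedError (hpos : ∀ w, 0 < S.weight true w + S.weight false w)
    (hgap : ∀ w, 2 * S.weight true w ≤ S.weight false w ∨
      2 * S.weight false w ≤ S.weight true w) :
    S.toPCA.RecognizesBoundedError {w | S.weight false w < S.weight true w} := by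
  -- A verdict `b` that dominates by a factor of two wins with probability at least `2 / 3`.
  have key (w : List α) (b : Bool) (h : 2 * S.weight (!b) w ≤ S.weight b w) :
      1 - 1 / 3 ≤ S.verdictProb w b := by
    have h1 := S.weight_le_mul_verdictProb w b
    have hb : 0 < S.weight b w ∧ S.weight true w + S.weight false w ≤ 3 / 2 * S.weight b w := by
      have h2 := hpos w
      rw [← NNReal.coe_le_coe] at h ⊢
      rw [← NNReal.coe_pos] at h2 ⊢
      cases b <;> simp only [Bool.not_true, Bool.not_false] at h <;> push_cast at h h2 ⊢ <;>
        constructor <;> linarith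
    rcases eq_or_ne (S.verdictProb w b) ⊤ with hv | hv
    · rw [hv]; exact le_top
    lift S.verdictProb w b to ℝ≥0 using hv with v
    have h3 : S.weight b w ≤ (S.weight true w + S.weight false w) * v := by exact_mod_cast h1
    have h4 : (1 : ℝ≥0) ≤ 3 / 2 * v := by
      refine le_of_mul_le_mul_left ?_ hb.1
      calc S.weight b w * 1 = S.weight b w := mul_one _
        _ ≤ _ := h3
        _ ≤ 3 / 2 * S.weight b w * v := by gcongr; exact hb.2
        _ = _ := by ring
    have h5 : (1 : ℝ≥0∞) ≤ v + 1 / 3 := by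
      have : (1 : ℝ≥0) ≤ v + 1 / 3 := by
        rw [← NNReal.coe_le_coe] at h4 ⊢
        push_cast at h4 ⊢
        linarith
      have h6 : ((1 / 3 : ℝ≥0) : ℝ≥0∞) = 1 / 3 := by
        rw [ENNReal.coe_div (by norm_num)]; norm_num
      rw [← h6]
      exact_mod_cast this
    exact tsub_le_iff_right.2 h5
  refine ⟨1 / 3, ?_, fun w hw => ?_, fun w hw => ?_⟩
  · rw [one_div, one_div, ENNReal.inv_lt_inv]; norm_num
  · refine key w true ((hgap w).resolve_left fun h => ?_)
    exact absurd (le_mul_of_one_le_left' one_le_two |>.trans h) (not_le.2 hw)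
  · rcases hgap w with h | h
    · exact key w false h
    · have hw' : S.weight true w ≤ S.weight false w := not_lt.1 hw
      exfalso
      have h2 := hpos w
      rw [← NNReal.coe_le_coe] at h hw'
      rw [← NNReal.coe_pos] at h2
      push_cast at h h2
      linarith [(S.weight true w).coe_nonneg, (S.weight false w).coe_nonneg]

end ScanAutomaton

/-! ### Block words -/

/-- The word `b 0^{n₁} b 0^{n₂} ⋯`, where the separator `b` is `true`. -/
def blockTail : List ℕ → List Bool
  | [] => []
  | n :: l => true :: (List.replicate n false ++ blockTail l)

/-- The word with the blocks `r, n₁, n₂, …` of letters `false`. -/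
def blockWord (r : ℕ) (l : List ℕ) : List Bool := List.replicate r false ++ blockTail l

theorem exists_eq_blockWord (w : List Bool) : ∃ r l, w = blockWord r l := by
  induction w with
  | nil => exact ⟨0, [], rfl⟩
  | cons a w ih =>
    obtain ⟨r, l, rfl⟩ := ih
    cases a
    · exact ⟨r + 1, l, rfl⟩
    · exact ⟨0, r :: l, rfl⟩

/-- The blocks `n, l` are the consecutive powers of four from `4 ^ l.length` down to `1`. -/
def IsPowerChain : ℕ → List ℕ → Prop
  | n, [] => n = 1
  | n, m :: l => n = 4 * m ∧ IsPowerChain m l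

theorem IsPowerChain.eq_pow {n : ℕ} {l : List ℕ} (h : IsPowerChain n l) :
    n = 4 ^ l.length := by
  induction l generalizing n with
  | nil => simpa [IsPowerChain] using h
  | cons m l ih => rw [h.1, ih h.2, List.length_cons, pow_succ']

theorem exists_isPowerChain (k : ℕ) : ∃ l, IsPowerChain (4 ^ k) l := by
  induction k with
  | zero => exact ⟨[], rfl⟩
  | succ k ih =>
    obtain ⟨l, hl⟩ := ih
    exact ⟨4 ^ k :: l, pow_succ' 4 k, hl⟩

/-! ### Comparing consecutive blocks -/

/-- The product of the geometric means of `16⁻²ⁱ` and `16⁻²ʲ` over the pairs `(i, j)` of numbers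
that must be equal in a chain of powers of four. -/
noncomputable def geomProd : ℕ → List ℕ → ℝ≥0
  | n, [] => (1 / 16) ^ n * (1 / 16)
  | n, m :: l => (1 / 16) ^ n * (1 / 16) ^ (4 * m) * geomProd m l

/-- The product of the arithmetic means of `16⁻²ⁱ` and `16⁻²ʲ` over the pairs `(i, j)` of numbers
that must be equal in a chain of powers of four. -/
noncomputable def arithProd : ℕ → List ℕ → ℝ≥0
  | n, [] => (((1 / 16) ^ n) ^ 2 + (1 / 16) ^ 2) / 2
  | n, m :: l => (((1 / 16) ^ n) ^ 2 + ((1 / 16) ^ (4 * m)) ^ 2) / 2 * arithProd m l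

theorem geomProd_pos (n : ℕ) (l : List ℕ) : 0 < geomProd n l := by
  induction l generalizing n with
  | nil => rw [geomProd]; positivity
  | cons m l ih => rw [geomProd]; have := ih m; positivity

theorem mul_le_mean_sq (u v : ℝ≥0) : u * v ≤ (u ^ 2 + v ^ 2) / 2 := by
  rw [← NNReal.coe_le_coe]
  push_cast
  nlinarith [sq_nonneg ((u : ℝ) - v)]

/-- Unequal exponents make the two means differ by a factor of eight. -/
theorem eight_mul_le_mean_sq {i j : ℕ} (h : i ≠ j) :
    8 * ((1 / 16 : ℝ≥0) ^ i * (1 / 16) ^ j) ≤ (((1 / 16) ^ i) ^ 2 + ((1 / 16) ^ j) ^ 2) / 2 := by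
  wlog hij : i < j generalizing i j
  · have := this h.symm (lt_of_le_of_ne (not_lt.1 hij) h.symm)
    rwa [mul_comm ((1 / 16 : ℝ≥0) ^ i), add_comm]
  have h1 : (1 / 16 : ℝ≥0) ^ j ≤ (1 / 16) ^ i * (1 / 16) := by
    rw [← pow_succ]
    exact pow_le_pow_of_le_one (by positivity) (by rw [← NNReal.coe_le_coe]; norm_num) hij
  rw [← NNReal.coe_le_coe] at h1 ⊢
  push_cast at h1 ⊢
  set u : ℝ := (1 / 16) ^ i
  set v : ℝ := (1 / 16) ^ j
  have hu : 0 ≤ u := by positivity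
  nlinarith [mul_le_mul_of_nonneg_left h1 hu, sq_nonneg v]

theorem geomProd_le_arithProd (n : ℕ) (l : List ℕ) : geomProd n l ≤ arithProd n l := by
  induction l generalizing n with
  | nil => exact mul_le_mean_sq _ _
  | cons m l ih => exact mul_le_mul' (mul_le_mean_sq _ _) (ih m)

theorem IsPowerChain.geomProd_eq {n : ℕ} {l : List ℕ} (h : IsPowerChain n l) :
    arithProd n l = geomProd n l := by
  induction l generalizing n with
  | nil =>
    obtain rfl : n = 1 := h
    rw [geomProd, arithProd, ← NNReal.coe_inj]; norm_num
  | cons m l ih =>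
    rw [geomProd, arithProd, ih h.2, h.1, add_self_div_two, sq]

theorem eight_mul_geomProd_le {n : ℕ} {l : List ℕ} (h : ¬ IsPowerChain n l) :
    8 * geomProd n l ≤ arithProd n l := by
  induction l generalizing n with
  | nil => simpa [geomProd, arithProd] using eight_mul_le_mean_sq (j := 1) h
  | cons m l ih =>
    rw [geomProd, arithProd]
    by_cases hn : n = 4 * m
    · have hm : ¬ IsPowerChain m l := fun hm => h ⟨hn, hm⟩
      rw [mul_left_comm]
      exact mul_le_mul' (mul_le_mean_sq _ _) (ih hm)
    · rw [← mul_assoc]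
      exact mul_le_mul' (eight_mul_le_mean_sq hn) (geomProd_le_arithProd m l)

/-! ### The scan that compares the first block with a multiple of the second -/

/-- The states of the scan.  The prefix `acc` or `rej` tells which verdict the scan works for, and
the rest tells whether the head is in the first, in the second or in a later block.  A scan for
rejection measures the second block if `q = true` and the first block otherwise; the bits `p` and
`c` tell which term of the arithmetic mean has been chosen for the pair of the previous and the
current block, and for the pair of the current and the next block. -/
inductive BlockState : Type
  | accFirst
  | accSecond
  | accLater
  | rejFirst (q : Bool)
  | rejSecond (q c : Bool)
  | rejLater (p c : Bool)
  deriving DecidableEq, Fintype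

namespace BlockState

/-- The verdict a state works for. -/
def goal : BlockState → Bool
  | accFirst | accSecond | accLater => true
  | _ => false

/-- The successors of a state on the letter `true`, one for each outcome of a fair coin. -/
def next : BlockState → Bool → BlockState
  | accFirst, _ => accSecond
  | accSecond, _ => accLater
  | accLater, _ => accLater
  | rejFirst q, c => rejSecond q c
  | rejSecond _ c, c' => rejLater c c'
  | rejLater _ c, c' => rejLater c c'

/-- The probability to survive the letter `false`, which leaves the state unchanged. -/
noncomputable def decay (t : ℝ≥0) : BlockState → ℝ≥0
  | accFirst => 1 / 512
  | accSecond => 1 / 16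
  | accLater => 1 / 16 * (1 / 16) ^ 4
  | rejFirst q => if q then 1 else 1 / 512
  | rejSecond q c => (if q then t else 1) * if c then 1 else (1 / 16) ^ 2
  | rejLater p c => (if p then ((1 / 16) ^ 4) ^ 2 else 1) * if c then 1 else (1 / 16) ^ 2

/-- The probability that a state gives the verdict it works for at the end of the word.  The
equation that the last block has length one is tested here; a word with a single block is never
accepted. -/
noncomputable def final : BlockState → ℝ≥0
  | accFirst => 0
  | accSecond => 1 / 16
  | accLater => 1 / 16
  | rejFirst _ => 1
  | rejSecond _ c => if c then (1 / 16) ^ 2 else 1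
  | rejLater _ c => if c then (1 / 16) ^ 2 else 1

/-- The initial states: a scan for acceptance, and two kinds of scans for rejection. -/
def start : Option Bool → BlockState
  | none => accFirst
  | some q => rejFirst q

/-- The probabilities of the initial states.  Their ratio balances the two verdicts: it makes up
for the two kinds of scans for rejection, and leaves a margin of two. -/
noncomputable def startWeight : Option Bool → ℝ≥0
  | none => 1 / 2
  | some _ => 1 / 8

theorem decay_le_one {t : ℝ≥0} (ht : t ≤ 1) (s : BlockState) : decay t s ≤ 1 := by
  have h1 : (1 / 16 : ℝ≥0) ≤ 1 := by rw [← NNReal.coe_le_coe]; norm_num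
  have h2 : (1 / 512 : ℝ≥0) ≤ 1 := by rw [← NNReal.coe_le_coe]; norm_num
  rcases s with _ | _ | _ | q | ⟨q, c⟩ | ⟨p, c⟩ <;> simp only [decay]
  · exact h2
  · exact h1
  · exact mul_le_one' h1 (pow_le_one' h1 _)
  · split_ifs
    exacts [le_rfl, h2]
  · refine mul_le_one' ?_ ?_ <;> split_ifs
    exacts [ht, le_rfl, le_rfl, pow_le_one' h1 _]
  · refine mul_le_one' ?_ ?_ <;> split_ifs
    exacts [pow_le_one' (pow_le_one' h1 _) _, le_rfl, le_rfl, pow_le_one' h1 _]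

theorem final_le_one (s : BlockState) : final s ≤ 1 := by
  have h1 : (1 / 16 : ℝ≥0) ≤ 1 := by rw [← NNReal.coe_le_coe]; norm_num
  rcases s with _ | _ | _ | q | ⟨q, c⟩ | ⟨p, c⟩ <;> simp only [final]
  · exact zero_le_one
  · exact h1
  · exact h1
  · exact le_rfl
  all_goals
    split_ifs
    exacts [pow_le_one' h1 _, le_rfl]

end BlockState

open BlockState in
/-- The scan in which a scan for rejection that measures the second block survives each of its
letters with probability `t`, apart from the factors that test the equations. -/
noncomputable def blockAutomaton (t : ℝ≥0) (ht : t ≤ 1) : ScanAutomaton Bool where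
  σ := BlockState
  fintype_σ := inferInstance
  init s := ∑ o, if s = start o then startWeight o else 0
  trans s a s' := if a then ∑ c, if s' = s.next c then 1 / 2 else 0
    else if s' = s then s.decay t else 0
  out s b := if b = s.goal then s.final else 0
  init_le := by
    rw [Finset.sum_comm]
    simp only [Finset.sum_ite_eq', Finset.mem_univ, if_true, Fintype.sum_option, Fintype.sum_bool,
      startWeight]
    rw [← NNReal.coe_le_coe]
    norm_num
  trans_le s a := by
    cases a
    · simpa using decay_le_one ht s
    · simp only [if_true]
      rw [Finset.sum_comm]
      simp only [Finset.sum_ite_eq', Finset.mem_univ, if_true, Fintype.sum_bool]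
      rw [← NNReal.coe_le_coe]
      norm_num
  out_le s := by simpa using final_le_one s

namespace blockAutomaton

variable (t : ℝ≥0) (ht : t ≤ 1)

open BlockState

theorem val_nil (b : Bool) (s : BlockState) :
    (blockAutomaton t ht).val b [] s = if b = s.goal then s.final else 0 := rfl

theorem val_false (b : Bool) (w : List Bool) (s : BlockState) :
    (blockAutomaton t ht).val b (false :: w) s = s.decay t * (blockAutomaton t ht).val b w s := by
  change (∑ s', (if s' = s then s.decay t else 0) * _) = _
  simp

theorem val_true (b : Bool) (w : List Bool) (s : BlockState) :
    (blockAutomaton t ht).val b (true :: w) s =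
      1 / 2 * ((blockAutomaton t ht).val b w (s.next true) +
        (blockAutomaton t ht).val b w (s.next false)) := by
  change (∑ s', (∑ c, if s' = s.next c then (1 / 2 : ℝ≥0) else 0) * _) = _
  simp only [Finset.sum_mul]
  rw [Finset.sum_comm]
  simp [mul_add]

theorem weight_eq (b : Bool) (w : List Bool) :
    (blockAutomaton t ht).weight b w =
      1 / 2 * (blockAutomaton t ht).val b w accFirst +
        1 / 8 * ((blockAutomaton t ht).val b w (rejFirst true) +
          (blockAutomaton t ht).val b w (rejFirst false)) := by
  rw [ScanAutomaton.weight]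
  change (∑ s, (∑ o, if s = start o then startWeight o else 0) * _) = _
  simp only [Finset.sum_mul]
  rw [Finset.sum_comm]
  simp [mul_add, Fintype.sum_option, startWeight, start]

theorem val_replicate (b : Bool) (n : ℕ) (w : List Bool) (s : BlockState) :
    (blockAutomaton t ht).val b (List.replicate n false ++ w) s =
      s.decay t ^ n * (blockAutomaton t ht).val b w s := by
  induction n with
  | zero => simp
  | succ n ih => rw [List.replicate_succ, List.cons_append, val_false, ih, pow_succ', mul_assoc]

theorem val_eq_zero {b : Bool} {s : BlockState} (h : s.goal ≠ b) (w : List Bool) :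
    (blockAutomaton t ht).val b w s = 0 := by
  induction w generalizing s with
  | nil => rw [val_nil, if_neg h.symm]
  | cons a w ih =>
    cases a
    · rw [val_false, ih h, mul_zero]
    · have hn (c : Bool) : (s.next c).goal = s.goal := by cases s <;> rfl
      rw [val_true, ih (by rwa [hn]), ih (by rwa [hn]), add_zero, mul_zero]

theorem val_accLater (n : ℕ) (l : List ℕ) :
    (1 / 16) ^ n * (blockAutomaton t ht).val true (blockTail l) accLater = geomProd n l := by
  induction l generalizing n with
  | nil => simp [blockTail, val_nil, geomProd, goal, final]
  | cons m l ih =>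
    have h2 : (1 / 2 : ℝ≥0) + 1 / 2 = 1 := add_halves 1
    rw [blockTail, val_true, next, next, ← two_mul, val_replicate, geomProd, ← ih m, decay,
      mul_pow, ← pow_mul]
    ring

theorem val_accSecond (l : List ℕ) :
    (blockAutomaton t ht).val true (blockTail l) accSecond =
      (blockAutomaton t ht).val true (blockTail l) accLater := by
  cases l with
  | nil => rfl
  | cons m l => rw [blockTail, val_true, val_true]; rfl

/-- The random choices of the bits `c` expand the product of arithmetic means; the factor for the
block `n` that has just been read belongs to the pair whose bit is `c`. -/
theorem val_rejLater (p : Bool) (n : ℕ) (l : List ℕ) :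
    1 / 2 * ((blockAutomaton t ht).val false (blockTail l) (rejLater p true) +
      ((1 / 16) ^ 2) ^ n * (blockAutomaton t ht).val false (blockTail l) (rejLater p false)) =
      arithProd n l := by
  induction l generalizing n p with
  | nil =>
    simp only [blockTail, val_nil, arithProd, goal, final, if_true]
    rw [pow_right_comm]
    simp only [Bool.false_eq_true, if_false]
    ring
  | cons m l ih =>
    have h (c : Bool) : (blockAutomaton t ht).val false (blockTail (m :: l)) (rejLater p c) =
        (if c then ((1 / 16) ^ 4) ^ 2 else 1) ^ m * arithProd m l := by
      rw [blockTail, val_true, next, next, val_replicate, val_replicate, ← ih c m]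
      simp only [decay, if_true, Bool.false_eq_true, if_false, mul_pow, mul_one]
      ring
    rw [h, h, arithProd]
    simp only [if_true, Bool.false_eq_true, if_false, one_pow]
    rw [pow_mul, pow_right_comm _ 2 n, pow_right_comm _ 2 m]
    ring

theorem val_rejSecond (q c : Bool) (l : List ℕ) :
    (blockAutomaton t ht).val false (blockTail l) (rejSecond q c) =
      (blockAutomaton t ht).val false (blockTail l) (rejLater q c) := by
  cases l with
  | nil => rfl
  | cons m l => rw [blockTail, val_true, val_true]; rfl

theorem weight_true_nil (r : ℕ) : (blockAutomaton t ht).weight true (blockWord r []) = 0 := by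
  rw [weight_eq, val_eq_zero t ht (s := rejFirst true) (by simp [goal]),
    val_eq_zero t ht (s := rejFirst false) (by simp [goal]), blockWord, val_replicate, blockTail,
    val_nil]
  simp [final]

theorem weight_true_cons (r m : ℕ) (l : List ℕ) :
    (blockAutomaton t ht).weight true (blockWord r (m :: l)) =
      1 / 2 * ((1 / 512) ^ r * geomProd m l) := by
  have h2 : (1 / 2 : ℝ≥0) * 2 = 1 := by rw [← NNReal.coe_inj]; norm_num
  rw [weight_eq, val_eq_zero t ht (s := rejFirst true) (by simp [goal]),
    val_eq_zero t ht (s := rejFirst false) (by simp [goal]), blockWord, val_replicate, blockTail,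
    val_true, next, next, val_replicate, val_accSecond, ← val_accLater t ht m l, ← two_mul,
    ← mul_assoc (1 / 2) 2, h2]
  simp [decay]

theorem weight_false_cons (r m : ℕ) (l : List ℕ) :
    (blockAutomaton t ht).weight false (blockWord r (m :: l)) =
      1 / 8 * (((1 / 512) ^ r + t ^ m) * arithProd m l) := by
  have h (q : Bool) : (blockAutomaton t ht).val false (blockTail (m :: l)) (rejFirst q) =
      (if q then t else 1) ^ m * arithProd m l := by
    rw [blockTail, val_true, next, next, val_replicate, val_replicate, val_rejSecond,
      val_rejSecond, ← val_rejLater t ht q m l]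
    simp only [decay, if_true, Bool.false_eq_true, if_false, mul_pow, mul_one]
    ring
  rw [weight_eq, val_eq_zero t ht (s := accFirst) (by simp [goal]), blockWord, val_replicate,
    val_replicate, h, h]
  simp only [decay, if_true, Bool.false_eq_true, if_false, one_pow]
  ring

/-- Scans for rejection survive each letter with probability at least `2⁻⁴⁰`. -/
theorem val_rej_ge (h512 : 1 / 512 ≤ t) {s : BlockState} (hs : s.goal = false) (w : List Bool) :
    (1 / 2 ^ 40) ^ w.length * (1 / 256) ≤ (blockAutomaton t ht).val false w s := by
  induction w generalizing s with
  | nil =>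
    rw [val_nil, if_pos hs.symm, List.length_nil, pow_zero, one_mul]
    rcases s with _ | _ | _ | q | ⟨q, c⟩ | ⟨p, c⟩ <;> simp only [goal, final] at hs ⊢
    · cases hs
    · cases hs
    · cases hs
    all_goals
      try split_ifs
      all_goals
        rw [← NNReal.coe_le_coe]
        norm_num
  | cons a w ih =>
    rw [List.length_cons, pow_succ', mul_assoc]
    cases a
    · rw [val_false]
      refine mul_le_mul' ?_ (ih hs)
      have h1 : (1 / 2 ^ 40 : ℝ≥0) ≤ 1 / 512 * (1 / 16) ^ 2 := by
        rw [← NNReal.coe_le_coe]; norm_num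
      have h2 : (1 / 512 : ℝ≥0) ≤ 1 := by rw [← NNReal.coe_le_coe]; norm_num
      have h3 : (1 / 16 : ℝ≥0) ^ 2 ≤ 1 := by rw [← NNReal.coe_le_coe]; norm_num
      rcases s with _ | _ | _ | q | ⟨q, c⟩ | ⟨p, c⟩ <;> simp only [goal, decay] at hs ⊢
      · cases hs
      · cases hs
      · cases hs
      · split_ifs <;> rw [← NNReal.coe_le_coe] <;> norm_num
      · refine h1.trans (mul_le_mul' ?_ ?_) <;> split_ifs
        exacts [h512, h2, h3, le_rfl]
      · split_ifs <;> rw [← NNReal.coe_le_coe] <;> norm_num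
    · have hn (c : Bool) : (s.next c).goal = false := by cases s <;> first | rfl | cases hs
      rw [val_true]
      refine mul_le_mul' ?_ ((ih (hn true)).trans le_self_add)
      rw [← NNReal.coe_le_coe]; norm_num

theorem weight_false_ge (h512 : 1 / 512 ≤ t) (w : List Bool) :
    (1 / 2 ^ 40) ^ w.length * (1 / 2048) ≤ (blockAutomaton t ht).weight false w := by
  have h := val_rej_ge t ht h512 (s := rejFirst true) rfl w
  rw [weight_eq]
  refine le_trans ?_ (le_trans (mul_le_mul_right (h.trans le_self_add) (1 / 8)) le_add_self)
  rw [← NNReal.coe_le_coe]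
  push_cast
  linarith

theorem runsInExponentialExpectedTime (h512 : 1 / 512 ≤ t) :
    (blockAutomaton t ht).toPCA.RunsInExponentialExpectedTime := by
  refine ⟨fun n => (2 * n + 2) * (2 ^ (40 * n) * 2048), 41, fun w => ?_, ?_⟩
  · refine (ScanAutomaton.expectedTime_le _ w).trans ?_
    have h := weight_false_ge t ht h512 w
    have h1 : ((2 ^ (40 * w.length) * 2048 : ℕ) : ℝ≥0∞)⁻¹ ≤
        (blockAutomaton t ht).weight true w + (blockAutomaton t ht).weight false w := by
      refine le_trans ?_ le_add_self
      have h2 : ((2 ^ (40 * w.length) * 2048 : ℕ) : ℝ≥0)⁻¹ =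
          (1 / 2 ^ 40) ^ w.length * (1 / 2048) := by
        push_cast
        rw [mul_inv, pow_mul, one_div_pow, one_div, one_div]
      rw [← h2] at h
      have h3 : ((2 ^ (40 * w.length) * 2048 : ℕ) : ℝ≥0) ≠ 0 := by positivity
      rw [← ENNReal.coe_natCast, ← ENNReal.coe_inv h3]
      exact_mod_cast h
    rw [Nat.cast_mul]
    refine mul_le_mul' ?_ (ENNReal.inv_le_iff_inv_le.1 h1)
    rw [ScanAutomaton.roundLength]
    exact_mod_cast (by omega)
  · refine IsBigO.of_bound 4096 (Eventually.of_forall fun n => ?_)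
    have h1 : ((n + 1 : ℕ) : ℝ) ≤ ((2 ^ n : ℕ) : ℝ) := by exact_mod_cast Nat.lt_two_pow_self
    push_cast at h1 ⊢
    rw [Real.norm_of_nonneg (by positivity), Real.norm_of_nonneg (by positivity),
      show 41 * n = n + 40 * n by ring, pow_add]
    have h2 : (0 : ℝ) ≤ 2 ^ (40 * n) := by positivity
    nlinarith [mul_le_mul_of_nonneg_right h1 h2]

end blockAutomaton

/-! ### Uncountably many thresholds -/

/-- The threshold `∑ (dᵢ + 1) / 4 ^ (i + 1)` with base-four digits `1` and `2`: the fractional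
part of its product with a power of four is in `[1 / 3, 2 / 3]`. -/
noncomputable def threshold (d : ℕ → Bool) : ℝ := 1 / 3 + Cardinal.cantorFunction (1 / 4) d / 4

theorem threshold_injective : Function.Injective threshold := by
  intro d e h
  apply Cardinal.cantorFunction_injective (c := 1 / 4) (by norm_num) (by norm_num)
  simp only [threshold] at h
  linarith

theorem four_mul_threshold (d : ℕ → Bool) :
    4 * threshold d = ((1 + if d 0 then 1 else 0 : ℕ) : ℝ) + threshold fun n => d (n + 1) := by
  rw [threshold, threshold, Cardinal.cantorFunction_succ d (by norm_num) (by norm_num)]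
  cases d 0 <;> simp <;> ring

theorem threshold_mem (d : ℕ → Bool) : 1 / 3 ≤ threshold d ∧ threshold d ≤ 2 / 3 := by
  have h0 : 0 ≤ Cardinal.cantorFunction (1 / 4) d :=
    tsum_nonneg fun n => Cardinal.cantorFunctionAux_nonneg (by norm_num)
  have h1 : Cardinal.cantorFunction (1 / 4) d ≤ Cardinal.cantorFunction (1 / 4) fun _ => true :=
    Cardinal.cantorFunction_le (by norm_num) (by norm_num) fun _ _ => rfl
  have h2 := Cardinal.cantorFunction_succ (c := 1 / 4) (fun _ => true) (by norm_num) (by norm_num)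
  simp only [cond_true] at h2
  constructor <;> rw [threshold] <;> linarith

theorem threshold_mul_pow (d : ℕ → Bool) (k : ℕ) :
    ∃ (N : ℕ) (e : ℕ → Bool), threshold d * 4 ^ k = N + threshold e := by
  induction k generalizing d with
  | zero => exact ⟨0, d, by simp⟩
  | succ k ih =>
    obtain ⟨N, e, h⟩ := ih fun n => d (n + 1)
    refine ⟨(1 + if d 0 then 1 else 0) * 4 ^ k + N, e, ?_⟩
    have h4 := four_mul_threshold d
    rw [pow_succ', ← mul_assoc, mul_comm _ 4, h4, add_mul, h]
    push_cast
    ring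

/-- The multiples of a threshold by powers of four stay away from the natural numbers. -/
theorem threshold_gap (d : ℕ → Bool) (k r : ℕ) :
    (r : ℝ) < threshold d * 4 ^ k ∨ threshold d * 4 ^ k + 1 / 3 ≤ r := by
  obtain ⟨N, e, h⟩ := threshold_mul_pow d k
  obtain ⟨h1, h2⟩ := threshold_mem e
  rw [h]
  rcases le_or_gt r N with hr | hr
  · left
    have : (r : ℝ) ≤ N := by exact_mod_cast hr
    linarith
  · right
    have : (N : ℝ) + 1 ≤ r := by exact_mod_cast hr
    linarith

/-- The survival probability per letter of the second block that belongs to a threshold. -/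
noncomputable def thresholdDecay (d : ℕ → Bool) : ℝ≥0 := (1 / 512 : ℝ≥0) ^ threshold d

theorem thresholdDecay_le_one (d : ℕ → Bool) : thresholdDecay d ≤ 1 :=
  NNReal.rpow_le_one (by rw [← NNReal.coe_le_coe]; norm_num)
    (by linarith [(threshold_mem d).1])

theorem le_thresholdDecay (d : ℕ → Bool) : 1 / 512 ≤ thresholdDecay d := by
  conv_lhs => rw [← NNReal.rpow_one (1 / 512)]
  exact NNReal.rpow_le_rpow_of_exponent_ge (by positivity)
    (by rw [← NNReal.coe_le_coe]; norm_num) (by linarith [(threshold_mem d).2])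

theorem thresholdDecay_pow (d : ℕ → Bool) (m : ℕ) :
    thresholdDecay d ^ m = (1 / 512 : ℝ≥0) ^ (threshold d * m) := by
  rw [thresholdDecay, NNReal.rpow_mul, NNReal.rpow_natCast]

/-- The scan that belongs to a threshold. -/
noncomputable def thresholdAutomaton (d : ℕ → Bool) : ScanAutomaton Bool :=
  blockAutomaton (thresholdDecay d) (thresholdDecay_le_one d)

/-- The words on which the scan for a threshold prefers acceptance. -/
def thresholdLanguage (d : ℕ → Bool) : Language Bool :=
  {w | (thresholdAutomaton d).weight false w < (thresholdAutomaton d).weight true w}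

section Threshold

variable (d : ℕ → Bool) {r m : ℕ} {l : List ℕ}

theorem two_mul_weight_false_le (h : IsPowerChain m l) (hr : (r : ℝ) < threshold d * m) :
    2 * (thresholdAutomaton d).weight false (blockWord r (m :: l)) ≤
      (thresholdAutomaton d).weight true (blockWord r (m :: l)) := by
  have h1 : thresholdDecay d ^ m ≤ (1 / 512) ^ r := by
    rw [thresholdDecay_pow, ← NNReal.rpow_natCast]
    exact NNReal.rpow_le_rpow_of_exponent_ge (by positivity)
      (by rw [← NNReal.coe_le_coe]; norm_num) hr.le
  rw [thresholdAutomaton, blockAutomaton.weight_false_cons, blockAutomaton.weight_true_cons,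
    h.geomProd_eq]
  have h2 := mul_le_mul_left h1 (geomProd m l)
  rw [← NNReal.coe_le_coe] at h2 ⊢
  push_cast at h2 ⊢
  linarith

theorem two_mul_weight_true_le
    (h : ¬ IsPowerChain m l ∨ threshold d * m + 1 / 3 ≤ r) :
    2 * (thresholdAutomaton d).weight true (blockWord r (m :: l)) ≤
      (thresholdAutomaton d).weight false (blockWord r (m :: l)) := by
  suffices hs : 8 * ((1 / 512) ^ r * geomProd m l) ≤
      ((1 / 512) ^ r + thresholdDecay d ^ m) * arithProd m l by
    rw [thresholdAutomaton, blockAutomaton.weight_false_cons, blockAutomaton.weight_true_cons]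
    rw [← NNReal.coe_le_coe] at hs ⊢
    push_cast at hs ⊢
    linarith
  rcases h with h | h
  · rw [mul_left_comm]
    exact mul_le_mul' le_self_add (eight_mul_geomProd_le h)
  · rw [← mul_assoc]
    refine mul_le_mul' (le_trans ?_ le_add_self) (geomProd_le_arithProd m l)
    -- The cube root of `512` is the required factor.
    have h8 : (8 : ℝ≥0) = (1 / 512 : ℝ≥0) ^ (-(1 / 3) : ℝ) := by
      rw [one_div, NNReal.inv_rpow, NNReal.rpow_neg, inv_inv,
        show (512 : ℝ≥0) = 8 ^ (3 : ℝ) by norm_num, ← NNReal.rpow_mul]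
      norm_num
    rw [thresholdDecay_pow, ← NNReal.rpow_natCast, h8, ← NNReal.rpow_add (by positivity)]
    exact NNReal.rpow_le_rpow_of_exponent_ge (by positivity)
      (by rw [← NNReal.coe_le_coe]; norm_num) (by linarith)

theorem weight_gap (w : List Bool) :
    2 * (thresholdAutomaton d).weight true w ≤ (thresholdAutomaton d).weight false w ∨
      2 * (thresholdAutomaton d).weight false w ≤ (thresholdAutomaton d).weight true w := by
  obtain ⟨r, l, rfl⟩ := exists_eq_blockWord w
  rcases l with _ | ⟨m, l⟩
  · left
    rw [thresholdAutomaton, blockAutomaton.weight_true_nil, mul_zero]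
    exact zero_le
  · by_cases h : IsPowerChain m l
    · have hg := threshold_gap d l.length r
      have hm : (m : ℝ) = 4 ^ l.length := by rw [h.eq_pow]; push_cast; rfl
      rw [← hm] at hg
      exact hg.symm.imp (fun hr => two_mul_weight_true_le d (Or.inr hr))
        (two_mul_weight_false_le d h)
    · exact Or.inl (two_mul_weight_true_le d (Or.inl h))

theorem blockWord_mem_iff (h : IsPowerChain m l) :
    blockWord r (m :: l) ∈ thresholdLanguage d ↔ (r : ℝ) < threshold d * m := by
  have hpos : 0 < (thresholdAutomaton d).weight true (blockWord r (m :: l)) := by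
    rw [thresholdAutomaton, blockAutomaton.weight_true_cons]
    have := geomProd_pos m l
    positivity
  have hm : (m : ℝ) = 4 ^ l.length := by rw [h.eq_pow]; push_cast; rfl
  constructor
  · intro hw
    by_contra hr
    have hg := threshold_gap d l.length r
    rw [← hm] at hg
    have h1 := two_mul_weight_true_le d (l := l) (Or.inr (hg.resolve_left hr))
    exact absurd ((le_mul_of_one_le_left' one_le_two).trans h1) (not_le.2 hw)
  · intro hr
    have h1 := two_mul_weight_false_le d h hr
    change (thresholdAutomaton d).weight false _ < (thresholdAutomaton d).weight true _
    rw [← NNReal.coe_pos] at hpos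
    rw [← NNReal.coe_le_coe] at h1
    rw [← NNReal.coe_lt_coe]
    push_cast at h1
    linarith [((thresholdAutomaton d).weight false (blockWord r (m :: l))).coe_nonneg]

end Threshold

/-- Thresholds that differ are separated by a fraction `r / 4 ^ k`. -/
theorem thresholdLanguage_injective : Function.Injective thresholdLanguage := by
  intro d e h
  by_contra hne
  wlog hlt : threshold d < threshold e generalizing d e
  · exact this h.symm (Ne.symm hne)
      (lt_of_le_of_ne (not_lt.1 hlt) (threshold_injective.ne (Ne.symm hne)))
  obtain ⟨k, hk⟩ := pow_unbounded_of_one_lt (1 / (threshold e - threshold d))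
    (by norm_num : (1 : ℝ) < 4)
  obtain ⟨l, hl⟩ := exists_isPowerChain k
  rw [div_lt_iff₀ (sub_pos.2 hlt)] at hk
  set r := ⌈threshold d * (4 ^ k : ℕ)⌉₊
  have h0 : 0 ≤ threshold d * (4 ^ k : ℕ) :=
    mul_nonneg (by linarith [(threshold_mem d).1]) (Nat.cast_nonneg _)
  have h1 : threshold d * (4 ^ k : ℕ) ≤ r := Nat.le_ceil _
  have h2 : (r : ℝ) < threshold d * (4 ^ k : ℕ) + 1 := Nat.ceil_lt_add_one h0
  have he : blockWord r (4 ^ k :: l) ∈ thresholdLanguage e := by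
    rw [blockWord_mem_iff e hl]
    push_cast at h2 ⊢
    linarith
  rw [← h, blockWord_mem_iff d hl] at he
  exact absurd h1 (not_le.2 he)

theorem thresholdLanguage_recognized (d : ℕ → Bool) :
    ∃ M : TwoWayPCA Bool, M.IsSweeping ∧ M.RecognizesBoundedError (thresholdLanguage d) ∧
      (∀ s, M.RunsInSpace s) ∧ M.RunsInExponentialExpectedTime := by
  refine ⟨(thresholdAutomaton d).toPCA, ScanAutomaton.isSweeping _,
    ScanAutomaton.recognizesBoundedError _ (fun w => ?_) (weight_gap d),
    ScanAutomaton.runsInSpace _,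
    blockAutomaton.runsInExponentialExpectedTime _ _ (le_thresholdDecay d)⟩
  refine lt_of_lt_of_le ?_ le_add_self
  exact lt_of_lt_of_le (by positivity)
    (blockAutomaton.weight_false_ge _ _ (le_thresholdDecay d) w)

theorem not_countable_of_forall_thresholdLanguage_mem {C : Set (Language Bool)}
    (h : ∀ d, thresholdLanguage d ∈ C) : ¬ C.Countable := by
  intro hC
  have hr : (Set.range thresholdLanguage).Countable :=
    hC.mono (Set.range_subset_iff.2 h)
  have hd : Countable (ℕ → Bool) :=
    (Set.countable_univ_iff).1
      (Set.countable_of_injective_of_countable_image thresholdLanguage_injective.injOn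
        (Set.image_univ ▸ hr))
  have hc := Cardinal.mk_le_aleph0_iff.2 hd
  rw [← Cardinal.power_def, Cardinal.mk_bool, Cardinal.mk_nat] at hc
  exact absurd hc (not_le.2 (Cardinal.cantor _))

theorem mainTheorem11 :
    (∀ s : ℕ → ℕ, ¬ BddAbove (Set.range s) →
      ¬ Set.Countable {L : Language Bool | ∃ M : TwoWayPCA Bool,
          M.IsSweeping ∧ M.RecognizesBoundedError L ∧ M.RunsInSpace s}) ∧
    ¬ Set.Countable {L : Language Bool | ∃ M : TwoWayPCA Bool,
        M.IsSweeping ∧ M.RecognizesBoundedError L ∧ M.RunsInLogSpace ∧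
          M.RunsInExponentialExpectedTime} := by
  refine ⟨fun s _ => not_countable_of_forall_thresholdLanguage_mem fun d => ?_,
    not_countable_of_forall_thresholdLanguage_mem fun d => ?_⟩
  · obtain ⟨M, h1, h2, h3, -⟩ := thresholdLanguage_recognized d
    exact ⟨M, h1, h2, h3 s⟩
  · obtain ⟨M, h1, h2, h3, h4⟩ := thresholdLanguage_recognized d
    exact ⟨M, h1, h2, ⟨fun _ => 0, h3 _, by simpa using isBigO_zero _ _⟩, h4⟩
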